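/- Let $\mathscr U\subseteq\mathbb R^m$ and consider the linear stochastic system $$\mathbf M:\quad x(t+1)=Ax(t)+Bu(t)+w(t),\qquad z(t)=Hx(t),\qquad t=0,1,2,\dots$$ with state $x(t)\in\mathbb R^n$, input $u(t)\in\mathscr U$, output $z(t)\in\mathbb R^p$, initial state $x(0)\sim\mathcal N(\mu_0,\Sigma_0)$ and i.i.d. noise $w(t)\sim\mathcal N(0,Q_w)$, $Q_w\succeq 0$, independent of $x(0)$. Let $C\in\mathbb R^{q\times n}$ and $N\in\mathbb R^{p\times q}$ satisfy $NC=H$. Let $X\succ0$ be a stabilizing solution of the discrete-time algebraic Riccati equation $$X=AXA^T-AXC^T[CXC^T]^{-1}CXA^T+Q_w,$$ that is, $X$ solves this equation and all eigenvalues of $A-FC$, with $F=AXC^T(CXC^T)^{-1}$, lie in the open unit disc. Assume that $\Sigma_0-X\succ0$ and $CXC^T\succ0$. Put $K=XC^T(CXC^T)^{-1}$ and $P=X-KCX$, and let $\bar{\mathbf M}^*$ be the time-invariant system $$\bar{\mathbf M}^*:\quad \bar x(t+1)=A\bar x(t)+B\bar u(t)+Kv(t+1),\qquad \bar z(t)=H\bar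 x(t),$$ with $\bar u(t)\in\mathscr U$, $\bar x(0)\sim\mathcal N(\mu_0,\Sigma_0-P)$ and i.i.d. noise $v(t)\sim\mathcal N(0,CXC^T)$ in $\mathbb R^q$, independent of $\bar x(0)$. A controller is a sequence of measurable maps $\mathbf C_t$ that send the history $x(0)u(0)x(1)\cdots u(t-1)x(t)$ to an input $u(t)\in\mathscr U$. For a controller $\mathbf C$ of a system $\mathbf S$, let $\mathbb P_{\mathbf C\times\mathbf S}$ be the distribution on $(\mathbb R^p)^{\mathbb N}$ of the output trajectory of the controlled system. Given a controller $\bar{\mathbf C}^*$ of $\bar{\mathbf M}^*$, its refinement is the following controller of $\mathbf M$. With $R=(X^{-1}-\Sigma_0^{-1})^{-1}$ and $L=\Sigma_0(\Sigma_0+R)^{-1}$, draw once $\tilde w\sim\mathcal N(0,R)$, independently of $x(0)$ and $(w(t))_t$; compute $\bar\mu_0=\mu_0+L(x(0)+\tilde w-\mu_0)$ and $\bar x(0)=\bar\mu_0+K(Cx(0)-C\bar\mu_0)$; then, for $t=0,1,2,\dots$, apply to $\mathbf M$ the input $u(t)=\bar u(t)=\bar{\mathbf C}^*_t(\bar x(0)\bar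 u(0)\cdots\bar u(t-1)\bar x(t))$, observe $x(t+1)$, and compute $v(t+1)=Cx(t+1)-CA\bar x(t)-CB\bar u(t)$ and $\bar x(t+1)=A\bar x(t)+B\bar u(t)+Kv(t+1)$. Then for every controller $\bar{\mathbf C}^*$ of $\bar{\mathbf M}^*$: 1. for every Borel set $\mathcal Z_\phi\subseteq(\mathbb R^p)^{\mathbb N}$, the probability that the output trajectory of $\mathbf M$, controlled by the refinement of $\bar{\mathbf C}^*$, lies in $\mathcal Z_\phi$ equals $\mathbb P_{\bar{\mathbf C}^*\times\bar{\mathbf M}^*}(\mathcal Z_\phi)$; 2. for every Borel set $\mathcal Z_\phi\subseteq(\mathbb R^p)^{\mathbb N}$ there is a controller $\mathbf C$ of $\mathbf M$ (a sequence of measurable maps of the history, without auxiliary randomization) such that $\mathbb P_{\mathbf C\times\mathbf M}(\mathcal Z_\phi)=\mathbb P_{\bar{\mathbf C}^*\times\bar{\mathbf M}^*}(\mathcal Z_\phi)$. -/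

import Mathlib

open MeasureTheory ProbabilityTheory
open scoped Matrix

namespace NoiseReduction

/-- The Euclidean space `ℝᵏ` with its Borel `σ`-algebra. -/
abbrev Vec (k : ℕ) : Type := EuclideanSpace ℝ (Fin k)

/-- Finite executions `x(0) u(0) x(1) u(1) … u(t-1) x(t)`: alternating sequences of states in `ℝⁿ`
and inputs in `𝒰`, ending in a state. -/
def History (n : ℕ) {m : ℕ} (𝒰 : Set (Vec m)) : ℕ → Type
  | 0 => Vec n
  | t + 1 => History n 𝒰 t × 𝒰 × Vec n

/-- The product (Borel) `σ`-algebra on finite executions. -/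
instance History.instMeasurableSpace (n : ℕ) {m : ℕ} (𝒰 : Set (Vec m)) :
    (t : ℕ) → MeasurableSpace (History n 𝒰 t)
  | 0 => inferInstanceAs (MeasurableSpace (Vec n))
  | t + 1 =>
    letI := History.instMeasurableSpace n 𝒰 t
    inferInstanceAs (MeasurableSpace (History n 𝒰 t × 𝒰 × Vec n))

/-- The current state `x(t)` of a finite execution `x(0) u(0) … x(t)`. -/
def History.last {n m : ℕ} {𝒰 : Set (Vec m)} : {t : ℕ} → History n 𝒰 t → Vec n
  | 0, h => h
  | _ + 1, h => h.2.2

/-- A controller: a sequence of (measurable) policies `C_t`, each mapping the history at time `t`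
to an input in `𝒰`. -/
structure Controller (n : ℕ) {m : ℕ} (𝒰 : Set (Vec m)) where
  policy : (t : ℕ) → History n 𝒰 t → 𝒰
  measurable_policy : ∀ t, Measurable (policy t)

/-- A controller which, before the execution starts, makes one auxiliary draw `s` from the
probability distribution `seedLaw`, independently of the controlled system, and afterwards applies
policies that depend on `s` and on the history. -/
structure RandomizedController (n : ℕ) {m : ℕ} (𝒰 : Set (Vec m)) where
  Seed : Type
  measurableSpaceSeed : MeasurableSpace Seed
  seedLaw : Measure Seed
  isProbabilityMeasure_seedLaw : IsProbabilityMeasure seedLaw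
  policy : (t : ℕ) → Seed → History n 𝒰 t → 𝒰
  measurable_policy : ∀ t, Measurable (fun a : Seed × History n 𝒰 t => policy t a.1 a.2)

theorem measurable_toEuclideanLin {k l : ℕ} (D : Matrix (Fin k) (Fin l) ℝ) :
    Measurable (fun x : Vec l => D.toEuclideanLin x) :=
  (LinearMap.continuous_of_finiteDimensional D.toEuclideanLin).measurable

theorem measurable_last {n m : ℕ} {𝒰 : Set (Vec m)} : ∀ t : ℕ, Measurable (History.last : History n 𝒰 t → Vec n)
  | 0 => measurable_id
  | t + 1 => (measurable_snd.comp measurable_snd :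
      Measurable (fun h : History n 𝒰 t × 𝒰 × Vec n => h.2.2))

/-- The data of a time-invariant linear stochastic system
`x(t+1) = A x(t) + B u(t) + G ξ(t)`, `z(t) = H x(t)`, with `x(0) ∼ 𝒩(μ₀, S₀)` and with i.i.d. noise
`ξ(t) ∼ 𝒩(0, Q)` in `ℝʳ`, independent of `x(0)`. -/
structure LinearSystem (n m p r : ℕ) where
  A : Matrix (Fin n) (Fin n) ℝ
  B : Matrix (Fin n) (Fin m) ℝ
  G : Matrix (Fin n) (Fin r) ℝ
  H : Matrix (Fin p) (Fin n) ℝ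
  μ₀ : Vec n
  S₀ : Matrix (Fin n) (Fin n) ℝ
  Q : Matrix (Fin r) (Fin r) ℝ

namespace LinearSystem

variable {n m p r : ℕ} {𝒰 : Set (Vec m)}

/-- The joint law of the initial state `x(0)` and the noise sequence `ξ(0), ξ(1), …`. -/
noncomputable def noiseLaw (S : LinearSystem n m p r) : Measure (Vec n × (ℕ → Vec r)) :=
  (multivariateGaussian S.μ₀ S.S₀).prod
    (Measure.infinitePi fun _ : ℕ => multivariateGaussian (0 : Vec r) S.Q)

/-- The state update `A x + B u + G ξ`. -/
noncomputable def step (S : LinearSystem n m p r) (x : Vec n) (u : Vec m) (ξ : Vec r) : Vec n :=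
  S.A.toEuclideanLin x + S.B.toEuclideanLin u + S.G.toEuclideanLin ξ

/-- The execution up to time `t` of the system in closed loop with the policies `c`, for the
initial state `ω.1` and the noise sequence `ω.2`. -/
noncomputable def run (S : LinearSystem n m p r) (c : (t : ℕ) → History n 𝒰 t → 𝒰)
    (ω : Vec n × (ℕ → Vec r)) : (t : ℕ) → History n 𝒰 t
  | 0 => ω.1
  | t + 1 => (S.run c ω t, c t (S.run c ω t),
      S.step (S.run c ω t).last (c t (S.run c ω t)) (ω.2 t))

/-- The output trajectory `z(0) z(1) z(2) …` of the closed loop. -/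
noncomputable def output (S : LinearSystem n m p r) (c : (t : ℕ) → History n 𝒰 t → 𝒰)
    (ω : Vec n × (ℕ → Vec r)) : ℕ → Vec p :=
  fun t => S.H.toEuclideanLin (S.run c ω t).last

/-- The output trajectory depends measurably on the auxiliary draw, the initial state and the noise,
so that the push-forwards below are probability measures. -/
theorem measurable_output (S : LinearSystem n m p r) {Ω : Type} [MeasurableSpace Ω]
    (c : (t : ℕ) → Ω → History n 𝒰 t → 𝒰)
    (hc : ∀ t, Measurable (fun a : Ω × History n 𝒰 t => c t a.1 a.2)) :
    Measurable (fun a : Ω × (Vec n × (ℕ → Vec r)) => S.output (fun t => c t a.1) a.2) := by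
  have hrun : ∀ t, Measurable
      (fun a : Ω × (Vec n × (ℕ → Vec r)) => S.run (fun t => c t a.1) a.2 t) := by
    intro t
    induction t with
    | zero => exact measurable_fst.comp measurable_snd
    | succ t ih =>
      have hu := (hc t).comp (measurable_fst.prodMk ih)
      have hx := (measurable_last t).comp ih
      have hξ : Measurable (fun a : Ω × (Vec n × (ℕ → Vec r)) => a.2.2 t) :=
        (measurable_pi_apply t).comp (measurable_snd.comp measurable_snd)
      exact ih.prodMk (hu.prodMk ((((measurable_toEuclideanLin S.A).comp hx).add
        ((measurable_toEuclideanLin S.B).comp (measurable_subtype_coe.comp hu))).add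
        ((measurable_toEuclideanLin S.G).comp hξ)))
  exact measurable_pi_lambda _ fun t =>
    (measurable_toEuclideanLin S.H).comp ((measurable_last t).comp (hrun t))

/-- The distribution of the output trajectory of the controlled system `C × S`. -/
noncomputable def outputLaw (S : LinearSystem n m p r) (C : Controller n 𝒰) :
    Measure (ℕ → Vec p) :=
  S.noiseLaw.map (S.output C.policy)

/-- The distribution of the output trajectory of the system controlled by a randomized controller;
the auxiliary draw is independent of the initial state and of the noise. -/
noncomputable def randomizedOutputLaw (S : LinearSystem n m p r) (C : RandomizedController n 𝒰) :
    Measure (ℕ → Vec p) :=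
  letI := C.measurableSpaceSeed
  (C.seedLaw.prod S.noiseLaw).map fun a => S.output (fun t => C.policy t a.1) a.2

end LinearSystem

section Abstraction

variable {n m p q : ℕ}

/-- The original model `M`: `x(t+1) = A x(t) + B u(t) + w(t)`, `z(t) = H x(t)`, with
`x(0) ∼ 𝒩(μ₀, S₀)` and `w(t) ∼ 𝒩(0, Q_w)`. -/
def originalModel (A : Matrix (Fin n) (Fin n) ℝ) (B : Matrix (Fin n) (Fin m) ℝ)
    (H : Matrix (Fin p) (Fin n) ℝ) (μ₀ : Vec n) (S₀ Qw : Matrix (Fin n) (Fin n) ℝ) :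
    LinearSystem n m p n :=
  ⟨A, B, 1, H, μ₀, S₀, Qw⟩

/-- A square real matrix is (Schur) stable if all its complex eigenvalues lie in the open unit
disc. -/
def IsStable (F : Matrix (Fin n) (Fin n) ℝ) : Prop :=
  ∀ z ∈ spectrum ℂ (F.map (algebraMap ℝ ℂ)), ‖z‖ < 1

/-- `X ≻ 0` is a stabilizing solution of the discrete-time algebraic Riccati equation
`X = A X Aᵀ - A X Cᵀ (C X Cᵀ)⁻¹ C X Aᵀ + Q_w`: it solves the equation, and `A - F C` is stable for
`F = A X Cᵀ (C X Cᵀ)⁻¹`. -/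
structure IsStabilizingSolution (A : Matrix (Fin n) (Fin n) ℝ) (C : Matrix (Fin q) (Fin n) ℝ)
    (Qw X : Matrix (Fin n) (Fin n) ℝ) : Prop where
  posDef : X.PosDef
  riccati : X = A * X * Aᵀ - A * X * Cᵀ * (C * X * Cᵀ)⁻¹ * C * X * Aᵀ + Qw
  stable : IsStable (A - A * X * Cᵀ * (C * X * Cᵀ)⁻¹ * C)

/-- The constant gain `K = X Cᵀ (C X Cᵀ)⁻¹`. -/
noncomputable def gain (C : Matrix (Fin q) (Fin n) ℝ) (X : Matrix (Fin n) (Fin n) ℝ) :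
    Matrix (Fin n) (Fin q) ℝ :=
  X * Cᵀ * (C * X * Cᵀ)⁻¹

/-- The a posteriori covariance `P = X - K C X`. -/
noncomputable def posteriorCov (C : Matrix (Fin q) (Fin n) ℝ) (X : Matrix (Fin n) (Fin n) ℝ) :
    Matrix (Fin n) (Fin n) ℝ :=
  X - gain C X * C * X

/-- The time-invariant abstract model: `x̄(t+1) = A x̄(t) + B ū(t) + K v(t+1)`, `z̄(t) = H x̄(t)`, with
`x̄(0) ∼ 𝒩(μ₀, S₀ - P)` and `v(t) ∼ 𝒩(0, C X Cᵀ)`. (The noise `ξ(t)` of the general system is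
`v(t+1)`.) -/
noncomputable def abstractModel (A : Matrix (Fin n) (Fin n) ℝ) (B : Matrix (Fin n) (Fin m) ℝ)
    (H : Matrix (Fin p) (Fin n) ℝ) (μ₀ : Vec n) (S₀ : Matrix (Fin n) (Fin n) ℝ)
    (C : Matrix (Fin q) (Fin n) ℝ) (X : Matrix (Fin n) (Fin n) ℝ) : LinearSystem n m p q :=
  ⟨A, B, gain C X, H, μ₀, S₀ - posteriorCov C X, C * X * Cᵀ⟩

/-- The noise covariance `R = (X⁻¹ - S₀⁻¹)⁻¹` of the fictitious initial measurement
`ỹ = x(0) + w̃`, `w̃ ∼ 𝒩(0, R)`. -/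
noncomputable def fictitiousCov (S₀ X : Matrix (Fin n) (Fin n) ℝ) : Matrix (Fin n) (Fin n) ℝ :=
  (X⁻¹ - S₀⁻¹)⁻¹

/-- The gain `L = S₀ (S₀ + R)⁻¹` of the fictitious initial measurement. -/
noncomputable def fictitiousGain (S₀ X : Matrix (Fin n) (Fin n) ℝ) : Matrix (Fin n) (Fin n) ℝ :=
  S₀ * (S₀ + fictitiousCov S₀ X)⁻¹

/-- Initialization of the embedded abstract state: `μ̄₀ = μ₀ + L (x(0) + w̃ - μ₀)` and
`x̄(0) = μ̄₀ + K (C x(0) - C μ̄₀)`. -/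
noncomputable def embeddedInit (μ₀ : Vec n) (S₀ : Matrix (Fin n) (Fin n) ℝ)
    (C : Matrix (Fin q) (Fin n) ℝ) (X : Matrix (Fin n) (Fin n) ℝ) (w x : Vec n) : Vec n :=
  let μ' : Vec n := μ₀ + (fictitiousGain S₀ X).toEuclideanLin (x + w - μ₀)
  μ' + (gain C X).toEuclideanLin (C.toEuclideanLin x - C.toEuclideanLin μ')

/-- Update of the embedded abstract state, from `x̄ = x̄(t)`, the input `u = u(t)` and the new state
`x' = x(t+1)` of the original model: with `y(t+1) = C x(t+1)`,
`v(t+1) = y(t+1) - C A x̄(t) - C B u(t)` and `x̄(t+1) = A x̄(t) + B u(t) + K v(t+1)`. -/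
noncomputable def embeddedStep (A : Matrix (Fin n) (Fin n) ℝ) (B : Matrix (Fin n) (Fin m) ℝ)
    (C : Matrix (Fin q) (Fin n) ℝ) (X : Matrix (Fin n) (Fin n) ℝ)
    (xbar : Vec n) (u : Vec m) (x' : Vec n) : Vec n :=
  let v : Vec q := C.toEuclideanLin x' - (C * A).toEuclideanLin xbar - (C * B).toEuclideanLin u
  A.toEuclideanLin xbar + B.toEuclideanLin u + (gain C X).toEuclideanLin v

variable {𝒰 : Set (Vec m)}

/-- The execution `x̄(0) u(0) … u(t-1) x̄(t)` of the embedded abstract model, computed from the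
auxiliary draw `w = w̃` and the execution `x(0) u(0) … u(t-1) x(t)` of the original model. -/
noncomputable def embeddedHistory (A : Matrix (Fin n) (Fin n) ℝ) (B : Matrix (Fin n) (Fin m) ℝ)
    (μ₀ : Vec n) (S₀ : Matrix (Fin n) (Fin n) ℝ) (C : Matrix (Fin q) (Fin n) ℝ)
    (X : Matrix (Fin n) (Fin n) ℝ) (w : Vec n) : (t : ℕ) → History n 𝒰 t → History n 𝒰 t
  | 0, x => embeddedInit μ₀ S₀ C X w x
  | t + 1, h =>
    let hbar := embeddedHistory A B μ₀ S₀ C X w t h.1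
    (hbar, h.2.1, embeddedStep A B C X hbar.last h.2.1 h.2.2)

theorem measurable_embeddedHistory (A : Matrix (Fin n) (Fin n) ℝ) (B : Matrix (Fin n) (Fin m) ℝ)
    (μ₀ : Vec n) (S₀ : Matrix (Fin n) (Fin n) ℝ) (C : Matrix (Fin q) (Fin n) ℝ)
    (X : Matrix (Fin n) (Fin n) ℝ) : ∀ t : ℕ, Measurable
      (fun a : Vec n × History n 𝒰 t => embeddedHistory A B μ₀ S₀ C X a.1 t a.2)
  | 0 => by
    have hL := measurable_toEuclideanLin (fictitiousGain S₀ X)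
    have hK := measurable_toEuclideanLin (gain C X)
    have hC := measurable_toEuclideanLin C
    have hμ : Measurable (fun a : Vec n × Vec n =>
        μ₀ + (fictitiousGain S₀ X).toEuclideanLin (a.2 + a.1 - μ₀)) :=
      (hL.comp ((measurable_snd.add measurable_fst).sub_const μ₀)).const_add μ₀
    exact hμ.add (hK.comp ((hC.comp measurable_snd).sub (hC.comp hμ)))
  | t + 1 => by
    have ih := measurable_embeddedHistory A B μ₀ S₀ C X t
    have hA := measurable_toEuclideanLin A
    have hB := measurable_toEuclideanLin B
    have hC := measurable_toEuclideanLin C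
    have hCA := measurable_toEuclideanLin (C * A)
    have hCB := measurable_toEuclideanLin (C * B)
    have hK := measurable_toEuclideanLin (gain C X)
    have h1 : Measurable (fun a : Vec n × (History n 𝒰 t × 𝒰 × Vec n) =>
        embeddedHistory A B μ₀ S₀ C X a.1 t a.2.1) :=
      ih.comp (measurable_fst.prodMk (measurable_fst.comp measurable_snd))
    have hx := (measurable_last t).comp h1
    have hu : Measurable (fun a : Vec n × (History n 𝒰 t × 𝒰 × Vec n) => a.2.2.1) :=
      measurable_fst.comp (measurable_snd.comp measurable_snd)
    have hu' := measurable_subtype_coe.comp hu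
    have hy : Measurable (fun a : Vec n × (History n 𝒰 t × 𝒰 × Vec n) => a.2.2.2) :=
      measurable_snd.comp (measurable_snd.comp measurable_snd)
    exact h1.prodMk (hu.prodMk (((hA.comp hx).add (hB.comp hu')).add
      (hK.comp (((hC.comp hy).sub (hCA.comp hx)).sub (hCB.comp hu')))))

/-- The controller refinement algorithm: draw `w̃ ∼ 𝒩(0, R)`, run the embedded abstract model along
the execution of the original model, and apply to the original model the input that the abstract
controller `Cbar` selects for the execution of the embedded abstract model. -/
noncomputable def refine (A : Matrix (Fin n) (Fin n) ℝ) (B : Matrix (Fin n) (Fin m) ℝ)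
    (μ₀ : Vec n) (S₀ : Matrix (Fin n) (Fin n) ℝ) (C : Matrix (Fin q) (Fin n) ℝ)
    (X : Matrix (Fin n) (Fin n) ℝ) (Cbar : Controller n 𝒰) : RandomizedController n 𝒰 where
  Seed := Vec n
  measurableSpaceSeed := inferInstance
  seedLaw := multivariateGaussian 0 (fictitiousCov S₀ X)
  isProbabilityMeasure_seedLaw := inferInstance
  policy t w h := Cbar.policy t (embeddedHistory A B μ₀ S₀ C X w t h)
  measurable_policy t :=
    (Cbar.measurable_policy t).comp (measurable_embeddedHistory A B μ₀ S₀ C X t)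

end Abstraction

end NoiseReduction

/-! The proof is a coupling. Let `x̄` be the state that the refinement carries along and `e = x -
x̄` the estimation error. The input cancels from `e`: the pair of next error and innovation is `((1
- KC)(A e + w), C(A e + w))`, a fixed linear map `errorStep` of `(e, w)`. If `e ∼ 𝒩(0, P)`, the
Riccati equation gives `A e + w` covariance `X`; the new error has covariance `P` again, and `(1 -
KC) X Cᵀ = 0` makes it uncorrelated with, hence independent of, the innovation. So `𝒩(0, P)` is
stationary and the innovations are i.i.d. `𝒩(0, C X Cᵀ)` (`measurePreserving_errorStep`,
`measurePreserving_recOutput`).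

The fictitious measurement starts the error in this stationary regime: it lowers the covariance `S₀`
to `X`, the true measurement lowers `X` to `P`, and `x̄(0)` is independent of `e(0)`
(`measurePreserving_embeddedInit`). Thus `(x̄(0), v)` has exactly the law that drives the abstract
model. Since `C K = 1`, `C x̄ = C x` pathwise, and `H = N C` makes the outputs equal pathwise;
pushing forward gives the first claim.

For the second claim, some fixed seed gives the event at most its average probability and some other
seed at least that. Choosing between them by a threshold on a coordinate of `x(0)`, whose law has no
atoms, attains the average by the intermediate value theorem (`exists_selection_measure_eq`). -/

namespace NoiseReduction

/-! ### Linear images of independent Gaussian vectors -/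

section Gaussian

variable {a b k l : ℕ}

theorem inner_toEuclideanLin_left (D : Matrix (Fin k) (Fin l) ℝ) (x : Vec l) (t : Vec k) :
    inner ℝ (D.toEuclideanLin x) t = inner ℝ x (Dᵀ.toEuclideanLin t) := by
  have h := Matrix.toEuclideanLin_conjTranspose_eq_adjoint D
  rw [Matrix.conjTranspose_eq_transpose_of_trivial] at h
  rw [h, LinearMap.adjoint_inner_right]

/-- Two affine images of a pair of independent Gaussian vectors that are uncorrelated are
independent Gaussian vectors. -/
theorem map_prod_multivariateGaussian
    {m₁ : Vec a} {m₂ : Vec b} {S₁ : Matrix (Fin a) (Fin a) ℝ} {S₂ : Matrix (Fin b) (Fin b) ℝ}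
    (hS₁ : S₁.PosSemidef) (hS₂ : S₂.PosSemidef)
    (F₁ : Matrix (Fin k) (Fin a) ℝ) (F₂ : Matrix (Fin k) (Fin b) ℝ)
    (G₁ : Matrix (Fin l) (Fin a) ℝ) (G₂ : Matrix (Fin l) (Fin b) ℝ)
    (f : Vec k) (g : Vec l) {T₁ : Matrix (Fin k) (Fin k) ℝ} {T₂ : Matrix (Fin l) (Fin l) ℝ}
    (hT₁ : F₁ * S₁ * F₁ᵀ + F₂ * S₂ * F₂ᵀ = T₁) (hT₂ : G₁ * S₁ * G₁ᵀ + G₂ * S₂ * G₂ᵀ = T₂)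
    (h₀ : F₁ * S₁ * G₁ᵀ + F₂ * S₂ * G₂ᵀ = 0) :
    ((multivariateGaussian m₁ S₁).prod (multivariateGaussian m₂ S₂)).map
      (fun x => (f + (F₁.toEuclideanLin x.1 + F₂.toEuclideanLin x.2),
        g + (G₁.toEuclideanLin x.1 + G₂.toEuclideanLin x.2))) =
    (multivariateGaussian (f + (F₁.toEuclideanLin m₁ + F₂.toEuclideanLin m₂)) T₁).prod
      (multivariateGaussian (g + (G₁.toEuclideanLin m₁ + G₂.toEuclideanLin m₂)) T₂) := by
  have conj {i j : ℕ} {S : Matrix (Fin i) (Fin i) ℝ} (hS : S.PosSemidef)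
      (F : Matrix (Fin j) (Fin i) ℝ) : (F * S * Fᵀ).PosSemidef := by
    simpa using hS.mul_mul_conjTranspose_same F
  have hT₁' : T₁.PosSemidef := hT₁ ▸ (conj hS₁ F₁).add (conj hS₂ F₂)
  have hT₂' : T₂.PosSemidef := hT₂ ▸ (conj hS₁ G₁).add (conj hS₂ G₂)
  have hm : Measurable (fun x : Vec a × Vec b =>
      (f + (F₁.toEuclideanLin x.1 + F₂.toEuclideanLin x.2),
        g + (G₁.toEuclideanLin x.1 + G₂.toEuclideanLin x.2))) :=
    ((((measurable_toEuclideanLin F₁).comp measurable_fst).add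
      ((measurable_toEuclideanLin F₂).comp measurable_snd)).const_add f).prodMk
    ((((measurable_toEuclideanLin G₁).comp measurable_fst).add
      ((measurable_toEuclideanLin G₂).comp measurable_snd)).const_add g)
  have := Measure.isProbabilityMeasure_map
    (μ := (multivariateGaussian m₁ S₁).prod (multivariateGaussian m₂ S₂)) hm.aemeasurable
  -- A law on a product is a product law as soon as its characteristic function factors.
  refine (charFun_eq_prod_iff).1 fun t => ?_
  set t₁ := (WithLp.ofLp t).1 with ht₁
  set t₂ := (WithLp.ofLp t).2 with ht₂
  have key : charFun ((((multivariateGaussian m₁ S₁).prod (multivariateGaussian m₂ S₂)).map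
      (fun x => (f + (F₁.toEuclideanLin x.1 + F₂.toEuclideanLin x.2),
        g + (G₁.toEuclideanLin x.1 + G₂.toEuclideanLin x.2)))).map (WithLp.toLp 2)) t =
      Complex.exp (((inner ℝ f t₁ + inner ℝ g t₂ : ℝ) : ℂ) * Complex.I) *
      (charFun (multivariateGaussian m₁ S₁) (F₁ᵀ.toEuclideanLin t₁ + G₁ᵀ.toEuclideanLin t₂) *
        charFun (multivariateGaussian m₂ S₂)
          (F₂ᵀ.toEuclideanLin t₁ + G₂ᵀ.toEuclideanLin t₂)) := by
    rw [charFun_apply, charFun_apply, charFun_apply, ← integral_prod_mul,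
      ← integral_const_mul, integral_map, integral_map hm.aemeasurable]
    · refine integral_congr_ae (Filter.Eventually.of_forall fun x => ?_)
      simp only [WithLp.prod_inner_apply, ← Complex.exp_add]
      congr 1
      simp only [← ht₁, ← ht₂, inner_add_left, inner_add_right, inner_toEuclideanLin_left]
      push_cast
      ring
    · exact Measurable.aestronglyMeasurable (by fun_prop)
    · exact (MeasurableEquiv.toLp 2 (Vec k × Vec l)).measurable.aemeasurable
    · exact Measurable.aestronglyMeasurable (by fun_prop)
  rw [key, charFun_multivariateGaussian hS₁, charFun_multivariateGaussian hS₂,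
    charFun_multivariateGaussian hT₁', charFun_multivariateGaussian hT₂', ← Complex.exp_add,
    ← Complex.exp_add, ← Complex.exp_add]
  congr 1
  -- Symmetry of `S` merges the two mixed terms into one; summed over both sources these are the
  -- cross-covariance, which `h₀` kills.
  have quad : ∀ (i : ℕ) (S : Matrix (Fin i) (Fin i) ℝ) (F : Matrix (Fin k) (Fin i) ℝ)
      (G : Matrix (Fin l) (Fin i) ℝ), S.PosSemidef →
      (Fᵀ.toEuclideanLin t₁ + Gᵀ.toEuclideanLin t₂).ofLp ⬝ᵥ
        S *ᵥ (Fᵀ.toEuclideanLin t₁ + Gᵀ.toEuclideanLin t₂).ofLp =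
      t₁.ofLp ⬝ᵥ (F * S * Fᵀ) *ᵥ t₁.ofLp + t₂.ofLp ⬝ᵥ (G * S * Gᵀ) *ᵥ t₂.ofLp +
        2 * (t₁.ofLp ⬝ᵥ (F * S * Gᵀ) *ᵥ t₂.ofLp) := by
    intro i S F G hS
    have hsymm : Sᵀ = S := by
      simpa [Matrix.conjTranspose_eq_transpose_of_trivial] using hS.isHermitian.eq
    have e : ∀ (j j' : ℕ) (U : Matrix (Fin j) (Fin i) ℝ) (V : Matrix (Fin j') (Fin i) ℝ)
        (u : Fin j → ℝ) (v : Fin j' → ℝ),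
        (Uᵀ *ᵥ u) ⬝ᵥ S *ᵥ (Vᵀ *ᵥ v) = u ⬝ᵥ (U * S * Vᵀ) *ᵥ v := by
      intro j j' U V u v
      rw [Matrix.mulVec_transpose, ← Matrix.dotProduct_mulVec, Matrix.mulVec_mulVec,
        Matrix.mulVec_mulVec, Matrix.mul_assoc]
    have c : t₂.ofLp ⬝ᵥ (G * S * Fᵀ) *ᵥ t₁.ofLp = t₁.ofLp ⬝ᵥ (F * S * Gᵀ) *ᵥ t₂.ofLp := by
      rw [Matrix.dotProduct_mulVec, ← Matrix.mulVec_transpose, dotProduct_comm]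
      simp [Matrix.transpose_mul, hsymm, Matrix.mul_assoc]
    simp only [WithLp.ofLp_add, Matrix.ofLp_toLpLin, Matrix.toLin'_apply, Matrix.mulVec_add,
      dotProduct_add, add_dotProduct, e, c]
    ring
  have cross : t₁.ofLp ⬝ᵥ (F₁ * S₁ * G₁ᵀ) *ᵥ t₂.ofLp +
      t₁.ofLp ⬝ᵥ (F₂ * S₂ * G₂ᵀ) *ᵥ t₂.ofLp = 0 := by
    rw [← dotProduct_add, ← Matrix.add_mulVec, h₀]; simp
  rw [quad _ _ _ _ hS₁, quad _ _ _ _ hS₂, ← hT₁, ← hT₂]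
  simp only [Matrix.add_mulVec, dotProduct_add, inner_add_left,
    real_inner_comm _ t₁, real_inner_comm _ t₂, inner_toEuclideanLin_left,
    Matrix.transpose_transpose]
  have cross' : (t₁.ofLp ⬝ᵥ (F₂ * S₂ * G₂ᵀ) *ᵥ t₂.ofLp) =
      - (t₁.ofLp ⬝ᵥ (F₁ * S₁ * G₁ᵀ) *ᵥ t₂.ofLp) := by linarith
  rw [cross']
  push_cast
  ring

end Gaussian

/-! ### I.i.d. outputs of a stationary recursion -/

section Innovations

theorem measurableSet_initial {V : Type*} [MeasurableSpace V] (k : ℕ) {s : ℕ → Set V}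
    (hs : ∀ i, MeasurableSet (s i)) : MeasurableSet {x : ℕ → V | ∀ i < k, x i ∈ s i} := by
  simp only [Set.ofPred_forall]
  exact .iInter fun i => .iInter fun _ => measurable_pi_apply i (hs i)

/-- Every finite-dimensional box is a box over an initial segment of indices, after padding with
`Set.univ`. Initial segments are what an induction on time can handle. -/
theorem eq_infinitePi_of_initial {V : Type*} [MeasurableSpace V] (μ : Measure V)
    [IsProbabilityMeasure μ] {ν : Measure (ℕ → V)}
    (h : ∀ (k : ℕ) (s : ℕ → Set V), (∀ i, MeasurableSet (s i)) →
      ν {x | ∀ i < k, x i ∈ s i} = ∏ i ∈ Finset.range k, μ (s i)) :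
    ν = Measure.infinitePi fun _ => μ := by
  classical
  refine Measure.eq_infinitePi _ fun s t ht => ?_
  obtain ⟨k, hk⟩ := s.exists_nat_subset_range
  have h1 := h k (fun i => if i ∈ s then t i else Set.univ)
    (fun i => by by_cases hi : i ∈ s <;> simp [hi, ht])
  have h2 : {x : ℕ → V | ∀ i < k, x i ∈ if i ∈ s then t i else Set.univ} =
      Set.pi (s : Set ℕ) t := by
    ext x
    simp only [Set.mem_ofPred_eq, Set.mem_pi, Finset.mem_coe]
    refine ⟨fun H i hi => ?_, fun H i _ => ?_⟩
    · simpa [hi] using H i (Finset.mem_range.1 (hk hi))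
    · by_cases hi : i ∈ s <;> simp [hi, H]
  rw [← h2, h1, ← Finset.prod_subset hk]
  · exact Finset.prod_congr rfl fun i hi => by simp [hi]
  · intro i _ hi; simp [hi]

/-- Prepend a term to a sequence. -/
def seqCons {W : Type*} (a : W × (ℕ → W)) : ℕ → W
  | 0 => a.1
  | i + 1 => a.2 i

theorem measurePreserving_seqCons {W : Type*} [MeasurableSpace W] (μ : Measure W)
    [IsProbabilityMeasure μ] :
    MeasurePreserving seqCons (μ.prod (Measure.infinitePi fun _ : ℕ => μ))
      (Measure.infinitePi fun _ : ℕ => μ) := by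
  have hm : Measurable (seqCons (W := W)) := measurable_pi_lambda _ fun i => by
    cases i with
    | zero => exact measurable_fst
    | succ i => exact (measurable_pi_apply i).comp measurable_snd
  refine ⟨hm, eq_infinitePi_of_initial μ fun k s hs => ?_⟩
  rw [Measure.map_apply hm (measurableSet_initial k hs)]
  cases k with
  | zero => simp
  | succ k =>
    have h1 : seqCons ⁻¹' {x : ℕ → W | ∀ i < k + 1, x i ∈ s i} =
        s 0 ×ˢ (Set.pi (Finset.range k : Set ℕ) fun i => s (i + 1)) := by
      ext a
      simp only [Set.mem_preimage, Set.mem_ofPred_eq, Set.mem_prod, Set.mem_pi, Finset.mem_coe,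
        Finset.mem_range, Nat.forall_lt_succ_left, seqCons]
    rw [h1, Measure.prod_prod, Measure.infinitePi_pi _ fun i _ => hs _, Finset.prod_range_succ',
      mul_comm]

/-- The states of the recursion `e(t+1) = (T (e(t), w(t))).1`. -/
def recState {E W V : Type*} (T : E × W → E × V) (a : E × (ℕ → W)) : ℕ → E
  | 0 => a.1
  | t + 1 => (T (recState T a t, a.2 t)).1

/-- The outputs `v(t) = (T (e(t), w(t))).2` of the recursion `e(t+1) = (T (e(t), w(t))).1`. -/
def recOutput {E W V : Type*} (T : E × W → E × V) (a : E × (ℕ → W)) (t : ℕ) : V :=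
  (T (recState T a t, a.2 t)).2

/-- The time-shift property: after the first noise is consumed, the recursion restarts from the new
state with the remaining noise. -/
theorem recState_seqCons {E W V : Type*} (T : E × W → E × V) (e : E) (a : W × (ℕ → W)) (t : ℕ) :
    recState T (e, seqCons a) (t + 1) = recState T ((T (e, a.1)).1, a.2) t := by
  induction t with
  | zero => rfl
  | succ t ih => rw [recState, ih]; rfl

theorem recOutput_seqCons {E W V : Type*} (T : E × W → E × V) (e : E) (a : W × (ℕ → W)) (t : ℕ) :
    recOutput T (e, seqCons a) (t + 1) = recOutput T ((T (e, a.1)).1, a.2) t := by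
  rw [recOutput, recState_seqCons]; rfl

/-- If the law of `e` is stationary for the recursion and `T (e, w)` has independent components,
then the outputs are i.i.d. -/
theorem measurePreserving_recOutput {E W V : Type*} [MeasurableSpace E] [MeasurableSpace W]
    [MeasurableSpace V] {μE : Measure E} {μW : Measure W} {μV : Measure V}
    [IsProbabilityMeasure μE] [IsProbabilityMeasure μW] [IsProbabilityMeasure μV]
    {T : E × W → E × V} (hT : MeasurePreserving T (μE.prod μW) (μE.prod μV)) :
    MeasurePreserving (recOutput T) (μE.prod (Measure.infinitePi fun _ : ℕ => μW))
      (Measure.infinitePi fun _ : ℕ => μV) := by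
  have hst : ∀ t, Measurable fun a => recState T a t := fun t => by
    induction t with
    | zero => exact measurable_fst
    | succ t ih => exact measurable_fst.comp (hT.measurable.comp
        (ih.prodMk ((measurable_pi_apply t).comp measurable_snd)))
  have hm : Measurable (recOutput T) := measurable_pi_lambda _ fun t =>
    measurable_snd.comp (hT.measurable.comp
      ((hst t).prodMk ((measurable_pi_apply t).comp measurable_snd)))
  refine ⟨hm, eq_infinitePi_of_initial μV fun k => ?_⟩
  -- The sets `s` stay universally quantified, because the induction hypothesis is used for the
  -- shifted sets `s (i + 1)`.
  induction k with
  | zero =>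
    intro s hs
    rw [Measure.map_apply hm (measurableSet_initial 0 hs)]; simp
  | succ k ih =>
    intro s hs
    set π := Measure.infinitePi fun _ : ℕ => μW
    have hsplit : MeasurePreserving (fun x : (E × W) × (ℕ → W) => (x.1.1, seqCons (x.1.2, x.2)))
        ((μE.prod μW).prod π) (μE.prod π) :=
      ((MeasurePreserving.id μE).prod (measurePreserving_seqCons μW)).comp
        (measurePreserving_prodAssoc μE μW π)
    -- After one step, the first output is independent of the new state and the remaining noise, and
    -- these two have the original joint law. In these coordinates the event is a rectangle.
    have hT' : MeasurePreserving (fun x : (E × W) × (ℕ → W) =>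
          ((T x.1).2, ((T x.1).1, x.2))) ((μE.prod μW).prod π) (μV.prod (μE.prod π)) :=
      ((measurePreserving_prodAssoc μV μE π).comp
        ((Measure.measurePreserving_swap (μ := μE) (ν := μV)).prod (MeasurePreserving.id π))).comp
          (hT.prod (MeasurePreserving.id π))
    have hpre : (fun x : (E × W) × (ℕ → W) => (x.1.1, seqCons (x.1.2, x.2))) ⁻¹'
          (recOutput T ⁻¹' {x | ∀ i < k + 1, x i ∈ s i}) =
        (fun x : (E × W) × (ℕ → W) => ((T x.1).2, ((T x.1).1, x.2))) ⁻¹'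
          (s 0 ×ˢ (recOutput T ⁻¹' {x | ∀ i < k, x i ∈ s (i + 1)})) := by
      ext x
      simp only [Set.mem_preimage, Set.mem_ofPred_eq, Set.mem_prod, Nat.forall_lt_succ_left,
        recOutput_seqCons]
      rfl
    have hm1 := hm (measurableSet_initial (k + 1) hs)
    have hm2 := hm (measurableSet_initial k (s := fun i => s (i + 1)) fun i => hs _)
    have ih' := ih (fun i => s (i + 1)) fun i => hs _
    rw [Measure.map_apply hm (measurableSet_initial k fun i => hs _)] at ih'
    rw [Measure.map_apply hm (measurableSet_initial _ hs), ← hsplit.measure_preimage hm1.nullMeasurableSet, hpre,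
      hT'.measure_preimage ((hs 0).prod hm2).nullMeasurableSet, Measure.prod_prod, ih',
      Finset.prod_range_succ', mul_comm]

end Innovations

/-! ### Kalman filter identities and the fictitious measurement -/

section Covariances

variable {n q : ℕ} {A S₀ Qw X : Matrix (Fin n) (Fin n) ℝ} {C : Matrix (Fin q) (Fin n) ℝ}

theorem transpose_eq_of_posDef {k : ℕ} {S : Matrix (Fin k) (Fin k) ℝ} (hS : S.PosDef) :
    Sᵀ = S := by
  simpa [Matrix.conjTranspose_eq_transpose_of_trivial] using hS.isHermitian.eq

theorem inv_mul_of_posDef {k : ℕ} {S : Matrix (Fin k) (Fin k) ℝ} (hS : S.PosDef) :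
    S⁻¹ * S = 1 :=
  Matrix.nonsing_inv_mul S ((Matrix.isUnit_iff_isUnit_det S).1 hS.isUnit)

theorem mul_inv_of_posDef {k : ℕ} {S : Matrix (Fin k) (Fin k) ℝ} (hS : S.PosDef) :
    S * S⁻¹ = 1 :=
  Matrix.mul_nonsing_inv S ((Matrix.isUnit_iff_isUnit_det S).1 hS.isUnit)

theorem gain_mul (hCXC : (C * X * Cᵀ).PosDef) : gain C X * (C * X * Cᵀ) = X * Cᵀ := by
  rw [gain, Matrix.mul_assoc, inv_mul_of_posDef hCXC, Matrix.mul_one]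

theorem mul_gain (hCXC : (C * X * Cᵀ).PosDef) : C * gain C X = 1 := by
  rw [gain, ← Matrix.mul_assoc, ← Matrix.mul_assoc, mul_inv_of_posDef hCXC]

/-- Orthogonality principle: the filtered error is uncorrelated with the measured quantity. -/
theorem one_sub_gain_mul_cov (hCXC : (C * X * Cᵀ).PosDef) :
    (1 - gain C X * C) * X * Cᵀ = 0 := by
  have h := gain_mul hCXC
  simp only [Matrix.sub_mul, Matrix.one_mul, Matrix.mul_assoc] at h ⊢
  rw [h, sub_self]

theorem cov_mul_one_sub_gain (hX : X.PosDef) (hCXC : (C * X * Cᵀ).PosDef) :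
    C * X * (1 - gain C X * C)ᵀ = 0 := by
  have h := congrArg Matrix.transpose (one_sub_gain_mul_cov hCXC)
  simpa only [Matrix.transpose_mul, Matrix.transpose_transpose, transpose_eq_of_posDef hX,
    Matrix.transpose_zero, ← Matrix.mul_assoc] using h

/-- Joseph form of `P`; it exhibits `P` as a covariance, hence as positive semidefinite. -/
theorem posteriorCov_eq (hX : X.PosDef) (hCXC : (C * X * Cᵀ).PosDef) :
    (1 - gain C X * C) * X * (1 - gain C X * C)ᵀ = posteriorCov C X := by
  have h := cov_mul_one_sub_gain hX hCXC
  have h' := congrArg Matrix.transpose h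
  rw [Matrix.transpose_mul, Matrix.transpose_mul, Matrix.transpose_transpose,
    transpose_eq_of_posDef hX, Matrix.transpose_zero, ← Matrix.mul_assoc] at h'
  calc (1 - gain C X * C) * X * (1 - gain C X * C)ᵀ
      = (1 - gain C X * C) * X - ((1 - gain C X * C) * X * Cᵀ) * (gain C X)ᵀ := by
        rw [Matrix.transpose_sub, Matrix.transpose_one, Matrix.transpose_mul, Matrix.mul_sub,
          Matrix.mul_one, Matrix.mul_assoc _ Cᵀ]
    _ = posteriorCov C X := by
        rw [h', Matrix.zero_mul, sub_zero, posteriorCov, Matrix.sub_mul, Matrix.one_mul]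

theorem posteriorCov_posSemidef (hX : X.PosDef) (hCXC : (C * X * Cᵀ).PosDef) :
    (posteriorCov C X).PosSemidef := by
  rw [← posteriorCov_eq hX hCXC]
  rw [← Matrix.conjTranspose_eq_transpose_of_trivial (1 - gain C X * C)]
  exact hX.posSemidef.mul_mul_conjTranspose_same _

/-- The Riccati equation read as a prediction step from `P` back to `X`. -/
theorem IsStabilizingSolution.predict (hX : IsStabilizingSolution A C Qw X) :
    A * posteriorCov C X * Aᵀ + Qw = X := by
  conv_rhs => rw [hX.riccati]
  simp only [posteriorCov, gain, Matrix.mul_sub, Matrix.sub_mul, Matrix.mul_assoc]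

theorem posDef_initialCov (hX : X.PosDef) (hSX : (S₀ - X).PosDef) : S₀.PosDef := by
  simpa using hSX.add hX

/-- The matrix inversion lemma; the right-hand side is visibly positive semidefinite. -/
theorem fictitiousCov_eq (hX : X.PosDef) (hSX : (S₀ - X).PosDef) :
    fictitiousCov S₀ X = X + X * (S₀ - X)⁻¹ * X := by
  have hS := posDef_initialCov hX hSX
  refine Matrix.inv_eq_right_inv ?_
  have h1 : X + X * (S₀ - X)⁻¹ * X = S₀ * (S₀ - X)⁻¹ * X := by
    have h : (S₀ - X) * (S₀ - X)⁻¹ * X = X := by rw [mul_inv_of_posDef hSX, Matrix.one_mul]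
    rw [Matrix.sub_mul, Matrix.sub_mul, sub_eq_iff_eq_add] at h
    exact h.symm
  rw [Matrix.sub_mul]
  nth_rewrite 2 [h1]
  rw [Matrix.mul_add, Matrix.mul_assoc X, ← Matrix.mul_assoc X⁻¹ X, Matrix.mul_assoc S₀,
    ← Matrix.mul_assoc S₀⁻¹ S₀, inv_mul_of_posDef hX, inv_mul_of_posDef hS, Matrix.one_mul,
    add_sub_cancel_right]

theorem fictitiousCov_posSemidef (hX : X.PosDef) (hSX : (S₀ - X).PosDef) :
    (fictitiousCov S₀ X).PosSemidef := by
  rw [fictitiousCov_eq hX hSX]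
  have h := hSX.inv.posSemidef.mul_mul_conjTranspose_same X
  rw [Matrix.conjTranspose_eq_transpose_of_trivial, transpose_eq_of_posDef hX] at h
  exact hX.posSemidef.add h

theorem initialCov_add_fictitiousCov (hX : X.PosDef) (hSX : (S₀ - X).PosDef) :
    S₀ + fictitiousCov S₀ X = S₀ * (S₀ - X)⁻¹ * S₀ := by
  rw [fictitiousCov_eq hX hSX]
  generalize hD : S₀ - X = D at hSX
  obtain rfl : S₀ = D + X := by rw [← hD]; abel
  have h1 := inv_mul_of_posDef hSX
  have h2 := mul_inv_of_posDef hSX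
  calc D + X + (X + X * D⁻¹ * X) = (D * D⁻¹) * D + (D * D⁻¹) * X + X * (D⁻¹ * D)
        + X * D⁻¹ * X := by rw [h1, h2]; noncomm_ring
    _ = (D + X) * D⁻¹ * (D + X) := by noncomm_ring

theorem fictitiousGain_eq (hX : X.PosDef) (hSX : (S₀ - X).PosDef) :
    fictitiousGain S₀ X = (S₀ - X) * S₀⁻¹ := by
  have hS := posDef_initialCov hX hSX
  rw [fictitiousGain, initialCov_add_fictitiousCov hX hSX, Matrix.mul_inv_rev, Matrix.mul_inv_rev,
    Matrix.nonsing_inv_nonsing_inv _ ((Matrix.isUnit_iff_isUnit_det _).1 hSX.isUnit),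
    ← Matrix.mul_assoc, mul_inv_of_posDef hS, Matrix.one_mul]

/-- Equivalently `(1 - L) S₀ = X`: the fictitious measurement leaves error covariance exactly `X`.
-/
theorem fictitiousGain_mul (hX : X.PosDef) (hSX : (S₀ - X).PosDef) :
    fictitiousGain S₀ X * S₀ = S₀ - X := by
  rw [fictitiousGain_eq hX hSX, Matrix.mul_assoc, inv_mul_of_posDef (posDef_initialCov hX hSX),
    Matrix.mul_one]

theorem mul_fictitiousGain_transpose (hX : X.PosDef) (hSX : (S₀ - X).PosDef) :
    S₀ * (fictitiousGain S₀ X)ᵀ = S₀ - X := by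
  have h := congrArg Matrix.transpose (fictitiousGain_mul hX hSX)
  rwa [Matrix.transpose_mul, transpose_eq_of_posDef (posDef_initialCov hX hSX),
    transpose_eq_of_posDef hSX] at h

theorem fictitiousGain_conj_fictitiousCov (hX : X.PosDef) (hSX : (S₀ - X).PosDef) :
    fictitiousGain S₀ X * fictitiousCov S₀ X * (fictitiousGain S₀ X)ᵀ =
      (S₀ - X) - (S₀ - X) * (fictitiousGain S₀ X)ᵀ := by
  have hS := posDef_initialCov hX hSX
  have h : fictitiousGain S₀ X * (S₀ + fictitiousCov S₀ X) = S₀ := by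
    rw [initialCov_add_fictitiousCov hX hSX, fictitiousGain_eq hX hSX, Matrix.mul_assoc S₀,
      Matrix.mul_assoc, ← Matrix.mul_assoc S₀⁻¹ S₀, inv_mul_of_posDef hS, Matrix.one_mul,
      ← Matrix.mul_assoc, mul_inv_of_posDef hSX, Matrix.one_mul]
  rw [Matrix.mul_add, fictitiousGain_mul hX hSX] at h
  rw [eq_sub_of_add_eq' h, Matrix.sub_mul, mul_fictitiousGain_transpose hX hSX]

/-- The covariance identities behind the independence of the initial abstract state and the initial
estimation error. -/
theorem initial_covariances {S X L R U : Matrix (Fin n) (Fin n) ℝ}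
    (hLS : L * S = S - X) (hSL : S * Lᵀ = S - X) (hLRL : L * R * Lᵀ = (S - X) - (S - X) * Lᵀ)
    (hU : U * X * (1 - U)ᵀ = 0) :
    ((1 - U) * L) * R * ((1 - U) * L)ᵀ + ((1 - U) * L + U) * S * ((1 - U) * L + U)ᵀ =
        S - (X - U * X) ∧
    (-((1 - U) * L)) * R * (-((1 - U) * L))ᵀ
        + ((1 - U) * (1 - L)) * S * ((1 - U) * (1 - L))ᵀ = (1 - U) * X * (1 - U)ᵀ ∧
    ((1 - U) * L) * R * (-((1 - U) * L))ᵀ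
        + ((1 - U) * L + U) * S * ((1 - U) * (1 - L))ᵀ = 0 := by
  -- With `U = KC`, `x̄(0)` has coefficients `(1 - U)L` on `w̃` and `(1 - U)L + U` on `x(0)`; the
  -- error `e(0)` has `-(1 - U)L` and `(1 - U)(1 - L)`. Each expansion below is regrouped so that `L
  -- S`, `S Lᵀ` and `L R Lᵀ` can be replaced.
  have hU' : U * X * Uᵀ = U * X := by
    rw [Matrix.transpose_sub, Matrix.transpose_one, Matrix.mul_sub, Matrix.mul_one] at hU
    exact (sub_eq_zero.1 hU).symm
  generalize hJ : 1 - U = J at hU ⊢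
  have hJt : Jᵀ = 1 - Uᵀ := by rw [← hJ, Matrix.transpose_sub, Matrix.transpose_one]
  refine ⟨?_, ?_, ?_⟩
  · rw [Matrix.transpose_add, Matrix.transpose_mul]
    calc _ = J * (L * R * Lᵀ) * Jᵀ + J * (L * S) * (Lᵀ * Jᵀ) + J * (L * S) * Uᵀ
          + U * (S * Lᵀ) * Jᵀ + U * S * Uᵀ := by noncomm_ring
      _ = (S - X) + U * X * Uᵀ := by
        rw [hLRL, hLS, hSL, hJt, ← hJ]; noncomm_ring
      _ = _ := by rw [hU']; abel
  · rw [Matrix.transpose_neg, Matrix.transpose_mul, Matrix.transpose_mul, Matrix.transpose_sub,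
      Matrix.transpose_one]
    calc _ = J * (L * R * Lᵀ + S - L * S - S * Lᵀ + (L * S) * Lᵀ) * Jᵀ := by noncomm_ring
      _ = _ := by rw [hLRL, hLS, hSL]; noncomm_ring
  · rw [Matrix.transpose_neg, Matrix.transpose_mul, Matrix.transpose_mul, Matrix.transpose_sub,
      Matrix.transpose_one]
    calc _ = J * (L * S - (L * S) * Lᵀ - L * R * Lᵀ) * Jᵀ + U * (S - S * Lᵀ) * Jᵀ := by
          noncomm_ring
      _ = U * X * Jᵀ := by rw [hLRL, hLS, hSL]; noncomm_ring
      _ = 0 := hU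

end Covariances

/-! ### Coupling of the original and abstract models -/

section Coupling

variable {n m p q : ℕ} {A S₀ Qw X : Matrix (Fin n) (Fin n) ℝ} {C : Matrix (Fin q) (Fin n) ℝ}

theorem toEuclideanLin_mul {i j k : ℕ} (D : Matrix (Fin i) (Fin j) ℝ) (E : Matrix (Fin j) (Fin k) ℝ)
    (x : Vec k) : (D * E).toEuclideanLin x = D.toEuclideanLin (E.toEuclideanLin x) := by
  apply (WithLp.ofLp_injective 2)
  simp [Matrix.mulVec_mulVec]

theorem toEuclideanLin_one (x : Vec n) : (1 : Matrix (Fin n) (Fin n) ℝ).toEuclideanLin x = x := by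
  apply (WithLp.ofLp_injective 2)
  simp

theorem toEuclideanLin_add {i j : ℕ} (D E : Matrix (Fin i) (Fin j) ℝ) (x : Vec j) :
    (D + E).toEuclideanLin x = D.toEuclideanLin x + E.toEuclideanLin x := by
  rw [map_add, LinearMap.add_apply]

theorem toEuclideanLin_sub {i j : ℕ} (D E : Matrix (Fin i) (Fin j) ℝ) (x : Vec j) :
    (D - E).toEuclideanLin x = D.toEuclideanLin x - E.toEuclideanLin x := by
  rw [map_sub, LinearMap.sub_apply]

theorem toEuclideanLin_neg {i j : ℕ} (D : Matrix (Fin i) (Fin j) ℝ) (x : Vec j) :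
    (-D).toEuclideanLin x = -D.toEuclideanLin x := by
  rw [map_neg, LinearMap.neg_apply]

/-- From the estimation error `e = x(t) - x̄(t)` and the noise `w = w(t)`, the next estimation error
`(1 - K C) (A e + w)` and the innovation `C (A e + w)`. -/
noncomputable def errorStep (A : Matrix (Fin n) (Fin n) ℝ) (C : Matrix (Fin q) (Fin n) ℝ)
    (X : Matrix (Fin n) (Fin n) ℝ) (a : Vec n × Vec n) : Vec n × Vec q :=
  ((1 - gain C X * C).toEuclideanLin (A.toEuclideanLin a.1 + a.2),
    C.toEuclideanLin (A.toEuclideanLin a.1 + a.2))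

theorem measurePreserving_errorStep (hQw : Qw.PosSemidef) (hX : IsStabilizingSolution A C Qw X)
    (hCXC : (C * X * Cᵀ).PosDef) :
    MeasurePreserving (errorStep A C X)
      ((multivariateGaussian 0 (posteriorCov C X)).prod (multivariateGaussian 0 Qw))
      ((multivariateGaussian 0 (posteriorCov C X)).prod
        (multivariateGaussian 0 (C * X * Cᵀ))) := by
  -- Since `A e + w` has covariance `X`, its images under `F` and `G` have cross-covariance `F X
  -- Gᵀ`. All three covariance conditions are instances.
  have conj : ∀ {i j : ℕ} (F : Matrix (Fin i) (Fin n) ℝ) (G : Matrix (Fin j) (Fin n) ℝ),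
      (F * A) * posteriorCov C X * (G * A)ᵀ + F * Qw * Gᵀ = F * X * Gᵀ := by
    intro i j F G
    conv_rhs => rw [← hX.predict]
    simp only [Matrix.transpose_mul, Matrix.mul_add, Matrix.add_mul, Matrix.mul_assoc]
  have hmap := map_prod_multivariateGaussian (m₁ := 0) (m₂ := 0)
    (posteriorCov_posSemidef hX.posDef hCXC) hQw
    ((1 - gain C X * C) * A) (1 - gain C X * C) (C * A) C 0 0
    (T₁ := posteriorCov C X) (T₂ := C * X * Cᵀ)
    ((conj _ _).trans (posteriorCov_eq hX.posDef hCXC)) (conj _ _)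
    ((conj _ _).trans (one_sub_gain_mul_cov hCXC))
  have hfun : (fun x : Vec n × Vec n =>
      ((0 : Vec n) + (((1 - gain C X * C) * A).toEuclideanLin x.1
          + (1 - gain C X * C).toEuclideanLin x.2),
        (0 : Vec q) + ((C * A).toEuclideanLin x.1 + C.toEuclideanLin x.2))) =
      errorStep A C X := by
    funext x
    simp only [errorStep, toEuclideanLin_mul, map_add, zero_add]
  rw [hfun] at hmap
  refine ⟨?_, by simpa using hmap⟩
  have hsum : Measurable fun a : Vec n × Vec n => A.toEuclideanLin a.1 + a.2 :=
    ((measurable_toEuclideanLin A).comp measurable_fst).add measurable_snd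
  exact ((measurable_toEuclideanLin _).comp hsum).prodMk ((measurable_toEuclideanLin _).comp hsum)

theorem measurePreserving_embeddedInit (μ₀ : Vec n) (hX : X.PosDef) (hSX : (S₀ - X).PosDef)
    (hCXC : (C * X * Cᵀ).PosDef) :
    MeasurePreserving (fun a : Vec n × Vec n =>
        (embeddedInit μ₀ S₀ C X a.1 a.2, a.2 - embeddedInit μ₀ S₀ C X a.1 a.2))
      ((multivariateGaussian 0 (fictitiousCov S₀ X)).prod (multivariateGaussian μ₀ S₀))
      ((multivariateGaussian μ₀ (S₀ - posteriorCov C X)).prod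
        (multivariateGaussian 0 (posteriorCov C X))) := by
  set L := fictitiousGain S₀ X with hL
  set U := gain C X * C with hUdef
  have hU : U * X * (1 - U)ᵀ = 0 := by
    rw [hUdef, Matrix.mul_assoc (gain C X), Matrix.mul_assoc,
      cov_mul_one_sub_gain hX hCXC, Matrix.mul_zero]
  obtain ⟨h1, h2, h3⟩ := initial_covariances (fictitiousGain_mul hX hSX)
    (mul_fictitiousGain_transpose hX hSX) (fictitiousGain_conj_fictitiousCov hX hSX) hU
  -- The constant that gives `x̄(0)` mean `μ₀`; the error gets `-f`, as the two components sum to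
  -- `x(0)`.
  set f : Vec n := μ₀ - ((1 - U) * L + U).toEuclideanLin μ₀ with hf
  have hmap := map_prod_multivariateGaussian (m₁ := 0) (m₂ := μ₀)
    (fictitiousCov_posSemidef hX hSX) (posDef_initialCov hX hSX).posSemidef
    ((1 - U) * L) ((1 - U) * L + U) (-((1 - U) * L)) ((1 - U) * (1 - L)) f (-f)
    (T₁ := S₀ - posteriorCov C X) (T₂ := posteriorCov C X) h1
    (h2.trans (posteriorCov_eq hX hCXC)) h3
  have hfun : (fun x : Vec n × Vec n =>
      (f + (((1 - U) * L).toEuclideanLin x.1 + ((1 - U) * L + U).toEuclideanLin x.2),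
        -f + ((-((1 - U) * L)).toEuclideanLin x.1
          + ((1 - U) * (1 - L)).toEuclideanLin x.2))) =
      fun a : Vec n × Vec n =>
        (embeddedInit μ₀ S₀ C X a.1 a.2, a.2 - embeddedInit μ₀ S₀ C X a.1 a.2) := by
    funext a
    simp only [embeddedInit, hf, hUdef, ← hL, toEuclideanLin_mul, toEuclideanLin_add,
      toEuclideanLin_sub, toEuclideanLin_neg, toEuclideanLin_one, Prod.mk.injEq]
    simp only [map_add, map_sub]
    constructor <;> abel
  have hm₁ : f + (((1 - U) * L).toEuclideanLin 0 + ((1 - U) * L + U).toEuclideanLin μ₀) = μ₀ := by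
    rw [map_zero, zero_add, hf, sub_add_cancel]
  have hm₂ : -f + ((-((1 - U) * L)).toEuclideanLin 0
      + ((1 - U) * (1 - L)).toEuclideanLin μ₀) = 0 := by
    simp only [hf, toEuclideanLin_mul, toEuclideanLin_add, toEuclideanLin_sub, toEuclideanLin_one,
      map_zero]
    simp only [map_sub]
    abel
  rw [hfun, hm₁, hm₂] at hmap
  refine ⟨?_, hmap⟩
  rw [← hfun]
  exact ((((measurable_toEuclideanLin _).comp measurable_fst).add
      ((measurable_toEuclideanLin _).comp measurable_snd)).const_add _).prodMk
    ((((measurable_toEuclideanLin _).comp measurable_fst).add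
      ((measurable_toEuclideanLin _).comp measurable_snd)).const_add _)

/-- The initial state and the noise of the embedded abstract model, as a function of the auxiliary
draw and of the initial state and the noise of the original model. -/
noncomputable def embeddedNoise (A : Matrix (Fin n) (Fin n) ℝ) (μ₀ : Vec n)
    (S₀ : Matrix (Fin n) (Fin n) ℝ) (C : Matrix (Fin q) (Fin n) ℝ) (X : Matrix (Fin n) (Fin n) ℝ)
    (a : Vec n × (Vec n × (ℕ → Vec n))) : Vec n × (ℕ → Vec q) :=
  (embeddedInit μ₀ S₀ C X a.1 a.2.1,
    recOutput (errorStep A C X) (a.2.1 - embeddedInit μ₀ S₀ C X a.1 a.2.1, a.2.2))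

/-- Composition of two maps up to reassociation: `(w̃, x(0))` to the independent pair `(x̄(0),
e(0))`, then `e(0)` and the noise to the innovations. -/
theorem measurePreserving_embeddedNoise (B : Matrix (Fin n) (Fin m) ℝ) (H : Matrix (Fin p) (Fin n) ℝ)
    (μ₀ : Vec n) (hQw : Qw.PosSemidef) (hX : IsStabilizingSolution A C Qw X)
    (hSX : (S₀ - X).PosDef) (hCXC : (C * X * Cᵀ).PosDef) :
    MeasurePreserving (embeddedNoise A μ₀ S₀ C X)
      ((multivariateGaussian 0 (fictitiousCov S₀ X)).prod
        (originalModel A B H μ₀ S₀ Qw).noiseLaw)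
      (abstractModel A B H μ₀ S₀ C X).noiseLaw :=
  (((MeasurePreserving.id _).prod
    (measurePreserving_recOutput (measurePreserving_errorStep hQw hX hCXC))).comp
      (measurePreserving_prodAssoc _ _ _)).comp
    (((measurePreserving_embeddedInit μ₀ hX.posDef hSX hCXC).prod (MeasurePreserving.id _)).comp
      ((measurePreserving_prodAssoc _ _ _).symm _))

variable {𝒰 : Set (Vec m)}

/-- The embedded abstract state reproduces the measurement `C x(t)` exactly. -/
theorem toEuclideanLin_embeddedHistory_last (B : Matrix (Fin n) (Fin m) ℝ) (μ₀ : Vec n)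
    (hCXC : (C * X * Cᵀ).PosDef) (w : Vec n) :
    ∀ (t : ℕ) (h : History n 𝒰 t),
      C.toEuclideanLin (embeddedHistory A B μ₀ S₀ C X w t h).last = C.toEuclideanLin h.last
  | 0, h => by
    change C.toEuclideanLin (embeddedInit μ₀ S₀ C X w h) = C.toEuclideanLin h
    simp only [embeddedInit]
    rw [map_add, ← toEuclideanLin_mul, mul_gain hCXC, toEuclideanLin_one, add_sub_cancel]
  | t + 1, h => by
    change C.toEuclideanLin (embeddedStep A B C X _ h.2.1 h.2.2) = C.toEuclideanLin h.2.2
    simp only [embeddedStep]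
    rw [map_add, ← toEuclideanLin_mul C (gain C X), mul_gain hCXC, toEuclideanLin_one, map_add,
      toEuclideanLin_mul, toEuclideanLin_mul]
    abel

/-- Both claims are pathwise and need a joint induction: substituting `x = x̄ + e` turns the
computed `v(t+1)` into `C(A e + w)`, and the input, common to both systems, drops out of the error.
-/
theorem embeddedHistory_run (B : Matrix (Fin n) (Fin m) ℝ) (H : Matrix (Fin p) (Fin n) ℝ)
    (μ₀ : Vec n) (c : (t : ℕ) → History n 𝒰 t → 𝒰) (a : Vec n × (Vec n × (ℕ → Vec n))) (t : ℕ) :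
    embeddedHistory A B μ₀ S₀ C X a.1 t ((originalModel A B H μ₀ S₀ Qw).run
        (fun t h => c t (embeddedHistory A B μ₀ S₀ C X a.1 t h)) a.2 t) =
      (abstractModel A B H μ₀ S₀ C X).run c (embeddedNoise A μ₀ S₀ C X a) t ∧
    ((originalModel A B H μ₀ S₀ Qw).run
        (fun t h => c t (embeddedHistory A B μ₀ S₀ C X a.1 t h)) a.2 t).last =
      ((abstractModel A B H μ₀ S₀ C X).run c (embeddedNoise A μ₀ S₀ C X a) t).last +
        recState (errorStep A C X) (a.2.1 - embeddedInit μ₀ S₀ C X a.1 a.2.1, a.2.2) t := by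
  induction t with
  | zero =>
    refine ⟨rfl, ?_⟩
    change a.2.1 = embeddedInit μ₀ S₀ C X a.1 a.2.1 + (a.2.1 - embeddedInit μ₀ S₀ C X a.1 a.2.1)
    rw [add_sub_cancel]
  | succ t ih =>
    obtain ⟨ih1, ih2⟩ := ih
    simp only [LinearSystem.run, embeddedHistory, ih1, ih2]
    set e := recState (errorStep A C X) (a.2.1 - embeddedInit μ₀ S₀ C X a.1 a.2.1, a.2.2) t with he
    set hb := (abstractModel A B H μ₀ S₀ C X).run c (embeddedNoise A μ₀ S₀ C X a) t
    have hv : (embeddedNoise A μ₀ S₀ C X a).2 t =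
        C.toEuclideanLin (A.toEuclideanLin e + a.2.2 t) := rfl
    have he' : recState (errorStep A C X)
        (a.2.1 - embeddedInit μ₀ S₀ C X a.1 a.2.1, a.2.2) (t + 1) =
        (1 - gain C X * C).toEuclideanLin (A.toEuclideanLin e + a.2.2 t) := rfl
    rw [he', hv]
    constructor
    · refine Prod.ext rfl (Prod.ext rfl ?_)
      simp only [embeddedStep, LinearSystem.step, originalModel, abstractModel, toEuclideanLin_mul,
        toEuclideanLin_one, map_add, map_sub]
      abel
    · simp only [History.last, LinearSystem.step, originalModel, abstractModel, toEuclideanLin_mul,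
        toEuclideanLin_one, toEuclideanLin_sub, map_add]
      abel

theorem output_refine (B : Matrix (Fin n) (Fin m) ℝ) {H : Matrix (Fin p) (Fin n) ℝ}
    {N : Matrix (Fin p) (Fin q) ℝ} (hNC : N * C = H)
    (μ₀ : Vec n) (hCXC : (C * X * Cᵀ).PosDef) (c : (t : ℕ) → History n 𝒰 t → 𝒰)
    (a : Vec n × (Vec n × (ℕ → Vec n))) :
    (originalModel A B H μ₀ S₀ Qw).output
        (fun t h => c t (embeddedHistory A B μ₀ S₀ C X a.1 t h)) a.2 =
      (abstractModel A B H μ₀ S₀ C X).output c (embeddedNoise A μ₀ S₀ C X a) := by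
  funext t
  simp only [LinearSystem.output]
  rw [← (embeddedHistory_run B H μ₀ c a t).1]
  simp only [originalModel, abstractModel]
  rw [← hNC, toEuclideanLin_mul, toEuclideanLin_mul, toEuclideanLin_embeddedHistory_last B μ₀ hCXC]

theorem LinearSystem.measurable_output_controller {r : ℕ} (S : LinearSystem n m p r)
    (C : Controller n 𝒰) : Measurable (S.output C.policy) := by
  have hC : ∀ t, Measurable (fun a : Unit × History n 𝒰 t => C.policy t a.2) :=
    fun t => (C.measurable_policy t).comp measurable_snd
  have h := S.measurable_output (Ω := Unit) (fun t _ => C.policy t) hC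
  have h' : Measurable fun ω : Vec n × (ℕ → Vec r) => ((), ω) := measurable_prodMk_left
  have hcomp := h.comp h'
  exact hcomp

theorem randomizedOutputLaw_refine (B : Matrix (Fin n) (Fin m) ℝ) {H : Matrix (Fin p) (Fin n) ℝ}
    {N : Matrix (Fin p) (Fin q) ℝ} (hNC : N * C = H) (μ₀ : Vec n) (hQw : Qw.PosSemidef)
    (hX : IsStabilizingSolution A C Qw X) (hSX : (S₀ - X).PosDef) (hCXC : (C * X * Cᵀ).PosDef)
    (Cbar : Controller n 𝒰) :
    (originalModel A B H μ₀ S₀ Qw).randomizedOutputLaw (refine A B μ₀ S₀ C X Cbar) =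
      (abstractModel A B H μ₀ S₀ C X).outputLaw Cbar := by
  have hΨ := measurePreserving_embeddedNoise B H μ₀ hQw hX hSX hCXC
  have hout := (abstractModel A B H μ₀ S₀ C X).measurable_output_controller Cbar
  rw [LinearSystem.outputLaw, ← hΨ.map_eq, Measure.map_map hout hΨ.measurable]
  have hfun : (fun a : Vec n × (Vec n × (ℕ → Vec n)) =>
      (originalModel A B H μ₀ S₀ Qw).output
        (fun t h => Cbar.policy t (embeddedHistory A B μ₀ S₀ C X a.1 t h)) a.2) =
      (abstractModel A B H μ₀ S₀ C X).output Cbar.policy ∘ embeddedNoise A μ₀ S₀ C X :=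
    funext fun a => output_refine B hNC μ₀ hCXC Cbar.policy a
  rw [← hfun]
  rfl

end Coupling

/-! ### Removing the auxiliary randomization -/

section Derandomization

/-- Up to a constant, the distribution function is the primitive of `1` with respect to an atomless
measure. -/
theorem continuous_measureReal_Iic (ρ : Measure ℝ) [IsFiniteMeasure ρ] [NullSingletonClass ρ] :
    Continuous fun a => ρ.real (Set.Iic a) := by
  have h : (fun a => ρ.real (Set.Iic a)) =
      fun a => ρ.real (Set.Iic 0) + ∫ _ in (0 : ℝ)..a, (1 : ℝ) ∂ρ := by
    funext a
    rw [← intervalIntegral.integral_Iic_sub_Iic (integrable_const _).integrableOn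
      (integrable_const _).integrableOn]
    simp
  rw [h]
  exact continuous_const.add
    (intervalIntegral.continuous_primitive (fun _ _ => intervalIntegrable_const) 0)

/-- The measure of a set that agrees with `U₁` where `r ≤ a` and with `U₂` where `r > a` takes every
value between the measures of `U₁` and `U₂`. -/
theorem exists_threshold_measure_eq {Ω : Type*} [MeasurableSpace Ω] {μ : Measure Ω}
    [IsProbabilityMeasure μ] {r : Ω → ℝ} (hr : Measurable r) [NullSingletonClass (μ.map r)] {U₁ U₂ : Set Ω}
    (hU₂ : MeasurableSet U₂) {c : ℝ} (h₁ : μ.real U₁ < c)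
    (h₂ : c < μ.real U₂) :
    ∃ a : ℝ, μ.real {ω | ω ∈ if r ω ≤ a then U₁ else U₂} = c := by
  have hρ : ∀ U : Set Ω, NullSingletonClass ((μ.restrict U).map r) := fun U =>
    ⟨fun x => by
      have h := measure_singleton (μ := μ.map r) x
      rw [Measure.map_apply hr (measurableSet_singleton x)] at h ⊢
      exact Measure.absolutelyContinuous_of_le Measure.restrict_le_self h⟩
  have hval : ∀ U : Set Ω, ∀ a, ((μ.restrict U).map r).real (Set.Iic a) =
      μ.real (U ∩ r ⁻¹' Set.Iic a) := fun U a => by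
    rw [map_measureReal_apply hr measurableSet_Iic,
      measureReal_restrict_apply (hr measurableSet_Iic), Set.inter_comm]
  have hcont : ∀ U : Set Ω, Continuous fun a => μ.real (U ∩ r ⁻¹' Set.Iic a) := fun U => by
    have := hρ U
    simpa only [hval] using continuous_measureReal_Iic ((μ.restrict U).map r)
  have hbot : ∀ U : Set Ω, Filter.Tendsto (fun a => μ.real (U ∩ r ⁻¹' Set.Iic a)) Filter.atBot
      (nhds 0) := fun U => by
    have hI := tendsto_measure_iInter_atBot (μ := (μ.restrict U).map r) (s := fun a : ℝ => Set.Iic a)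
      (fun _ => measurableSet_Iic.nullMeasurableSet) (fun _ _ => Set.Iic_subset_Iic.2)
      ⟨0, measure_ne_top _ _⟩
    have hempty : ⋂ a : ℝ, Set.Iic a = ∅ :=
      Set.eq_empty_of_forall_notMem fun x hx =>
        absurd (Set.mem_iInter.1 hx (x - 1)) (by simp)
    rw [hempty, measure_empty] at hI
    exact ((ENNReal.tendsto_toReal ENNReal.zero_ne_top).comp hI).congr (hval U)
  have htop : ∀ U : Set Ω, Filter.Tendsto (fun a => μ.real (U ∩ r ⁻¹' Set.Iic a)) Filter.atTop
      (nhds (μ.real U)) := fun U => by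
    have := (ENNReal.tendsto_toReal (measure_ne_top _ _)).comp
      (tendsto_measure_Iic_atTop ((μ.restrict U).map r))
    rw [Measure.map_apply hr .univ, Set.preimage_univ, Measure.restrict_apply_univ] at this
    exact this.congr (hval U)
  -- The measure of the switched set as a function of the threshold: continuous, with limits `μ U₂`
  -- at `-∞` and `μ U₁` at `+∞`.
  set Φ : ℝ → ℝ := fun a => μ.real (U₁ ∩ r ⁻¹' Set.Iic a) +
    (μ.real U₂ - μ.real (U₂ ∩ r ⁻¹' Set.Iic a)) with hΦ
  have hΦc : Continuous Φ := (hcont U₁).add (continuous_const.sub (hcont U₂))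
  have hΦbot : Filter.Tendsto Φ Filter.atBot (nhds (μ.real U₂)) := by
    simpa using (hbot U₁).add ((hbot U₂).const_sub (μ.real U₂))
  have hΦtop : Filter.Tendsto Φ Filter.atTop (nhds (μ.real U₁)) := by
    simpa using (htop U₁).add ((htop U₂).const_sub (μ.real U₂))
  obtain ⟨a, ha⟩ := mem_range_of_exists_le_of_exists_ge hΦc
    ((hΦtop.eventually (gt_mem_nhds h₁)).exists.imp fun _ h => h.le)
    ((hΦbot.eventually (lt_mem_nhds h₂)).exists.imp fun _ h => h.le)
  refine ⟨a, ?_⟩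
  have hset : {ω | ω ∈ if r ω ≤ a then U₁ else U₂} =
      (U₁ ∩ r ⁻¹' Set.Iic a) ∪ (U₂ \ r ⁻¹' Set.Iic a) := by
    ext ω
    by_cases h : r ω ≤ a <;> simp [h]
  have hI := hr (measurableSet_Iic (a := a))
  rw [hset, measureReal_union
    (Set.disjoint_left.2 fun ω h h' => h'.2 h.2) (hU₂.diff hI), ← ha, hΦ]
  have := measureReal_inter_add_sdiff (μ := μ) (s := U₂) hI
  simp only
  linarith

/-- An auxiliary random draw can be replaced by a function of a random variable without atoms, as far
as the probability of a single event is concerned. -/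
theorem exists_selection_measure_eq {W Ω : Type*} [MeasurableSpace W] [MeasurableSpace Ω]
    {ν : Measure W} {μ : Measure Ω} [IsProbabilityMeasure ν] [IsProbabilityMeasure μ]
    {r : Ω → ℝ} (hr : Measurable r) [NullSingletonClass (μ.map r)] {U : Set (W × Ω)} (hU : MeasurableSet U) :
    ∃ (w₁ w₂ : W) (a : ℝ), μ {ω | (if r ω ≤ a then w₁ else w₂, ω) ∈ U} = ν.prod μ U := by
  have hm := measurable_measure_prodMk_left (ν := μ) hU
  have hfin : ∫⁻ w, μ (Prod.mk w ⁻¹' U) ∂ν ≠ ⊤ := by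
    rw [← Measure.prod_apply hU]; exact measure_ne_top _ _
  -- The product measure is the average over `w` of the section measures, so some section lies at or
  -- below it and some at or above. In a case of equality no switching is needed and the threshold
  -- is arbitrary.
  obtain ⟨w₁, h₁⟩ := exists_le_lintegral (μ := ν) hm.aemeasurable
  obtain ⟨w₂, h₂⟩ := exists_lintegral_le (μ := ν) hfin
  rw [← Measure.prod_apply hU] at h₁ h₂
  rcases h₁.eq_or_lt with h₁ | h₁
  · exact ⟨w₁, w₁, 0, by simp only [ite_self]; exact h₁⟩
  rcases h₂.eq_or_lt with h₂ | h₂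
  · exact ⟨w₂, w₂, 0, by simp only [ite_self]; exact h₂.symm⟩
  obtain ⟨a, ha⟩ := exists_threshold_measure_eq hr
    (measurable_prodMk_left hU)
    ((ENNReal.toReal_lt_toReal (measure_ne_top _ _) (measure_ne_top _ _)).2 h₁)
    ((ENNReal.toReal_lt_toReal (measure_ne_top _ _) (measure_ne_top _ _)).2 h₂)
  refine ⟨w₁, w₂, a, ?_⟩
  rw [← ENNReal.toReal_eq_toReal_iff' (measure_ne_top _ _) (measure_ne_top _ _), ← ha, Measure.real]
  congr 2
  ext ω
  by_cases h : r ω ≤ a <;> simp [h]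

variable {n m p r : ℕ} {𝒰 : Set (Vec m)}

/-- The initial state `x(0)` of a finite execution `x(0) u(0) … x(t)`. -/
def History.first : {t : ℕ} → History n 𝒰 t → Vec n
  | 0, h => h
  | _ + 1, h => History.first h.1

theorem measurable_first : ∀ t : ℕ, Measurable (History.first : History n 𝒰 t → Vec n)
  | 0 => measurable_id
  | t + 1 => ((measurable_first t).comp measurable_fst :
      Measurable (fun h : History n 𝒰 t × 𝒰 × Vec n => h.1.first))

attribute [local instance] RandomizedController.measurableSpaceSeed
  RandomizedController.isProbabilityMeasure_seedLaw

/-- The controller without auxiliary randomization that computes the seed from the initial state. -/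
def RandomizedController.seedFromInitial (C : RandomizedController n 𝒰) (g : Vec n → C.Seed)
    (hg : Measurable g) : Controller n 𝒰 where
  policy t h := C.policy t (g h.first) h
  measurable_policy t :=
    (C.measurable_policy t).comp ((hg.comp (measurable_first t)).prodMk measurable_id)

/-- The history never loses `x(0)`, so the recomputed seed is the same at every time. -/
theorem LinearSystem.run_seedFromInitial (S : LinearSystem n m p r) (C : RandomizedController n 𝒰)
    {g : Vec n → C.Seed} (hg : Measurable g) (ω : Vec n × (ℕ → Vec r)) (t : ℕ) :
    S.run (C.seedFromInitial g hg).policy ω t = S.run (fun t => C.policy t (g ω.1)) ω t ∧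
      (S.run (fun t => C.policy t (g ω.1)) ω t).first = ω.1 := by
  induction t with
  | zero => exact ⟨rfl, rfl⟩
  | succ t ih =>
    refine ⟨?_, ih.2⟩
    have hu : (C.seedFromInitial g hg).policy t (S.run (fun t => C.policy t (g ω.1)) ω t) =
        C.policy t (g ω.1) (S.run (fun t => C.policy t (g ω.1)) ω t) := by
      change C.policy t (g (History.first _)) _ = _
      rw [ih.2]
    simp only [LinearSystem.run, ih.1, hu]
    rfl

theorem LinearSystem.outputLaw_seedFromInitial (S : LinearSystem n m p r)
    (C : RandomizedController n 𝒰) {g : Vec n → C.Seed} (hg : Measurable g)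
    {Z : Set (ℕ → Vec p)} (hZ : MeasurableSet Z) :
    S.outputLaw (C.seedFromInitial g hg) Z =
      S.noiseLaw {ω | S.output (fun t => C.policy t (g ω.1)) ω ∈ Z} := by
  have h : S.output (C.seedFromInitial g hg).policy =
      fun ω => S.output (fun t => C.policy t (g ω.1)) ω := by
    funext ω t
    simp only [LinearSystem.output, (S.run_seedFromInitial C hg ω t).1]
  have hm := S.measurable_output_controller (C.seedFromInitial g hg)
  rw [LinearSystem.outputLaw, Measure.map_apply hm hZ, h]
  rfl

instance LinearSystem.isProbabilityMeasure_noiseLaw (S : LinearSystem n m p r) :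
    IsProbabilityMeasure S.noiseLaw :=
  inferInstanceAs (IsProbabilityMeasure (Measure.prod _ _))

/-- A randomized controller of a system with a nondegenerate initial state can be replaced by a
controller without randomization, as far as the probability of a single event is concerned. -/
theorem LinearSystem.exists_controller_outputLaw_eq (S : LinearSystem n m p r) (hS : S.S₀.PosDef)
    (C : RandomizedController n 𝒰) (hC : n = 0 → Subsingleton C.Seed)
    {Z : Set (ℕ → Vec p)} (hZ : MeasurableSet Z) :
    ∃ Cor : Controller n 𝒰, S.outputLaw Cor Z = S.randomizedOutputLaw C Z := by
  have hm := S.measurable_output C.policy C.measurable_policy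
  have hlaw : S.randomizedOutputLaw C Z = C.seedLaw.prod S.noiseLaw
      ((fun a => S.output (fun t => C.policy t a.1) a.2) ⁻¹' Z) := Measure.map_apply hm hZ
  rw [hlaw]
  -- In dimension `0` there is no coordinate to threshold, but there `hC` leaves only one seed.
  rcases Nat.eq_zero_or_pos n with hn | hn
  · have := hC hn
    obtain ⟨s⟩ : Nonempty C.Seed := nonempty_of_isProbabilityMeasure C.seedLaw
    refine ⟨C.seedFromInitial (fun _ => s) measurable_const, ?_⟩
    rw [S.outputLaw_seedFromInitial C _ hZ, Measure.prod_apply (hm hZ)]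
    have hconst : ∀ s', S.noiseLaw (Prod.mk s' ⁻¹'
        ((fun a : C.Seed × _ => S.output (fun t => C.policy t a.1) a.2) ⁻¹' Z)) =
        S.noiseLaw {ω | S.output (fun t => C.policy t s) ω ∈ Z} := fun s' => by
      rw [Subsingleton.elim s' s]; rfl
    simp only [hconst, lintegral_const, measure_univ, mul_one]
  · let i : Fin n := ⟨0, hn⟩
    have hi : Measurable fun x : Vec n => x i := by fun_prop
    have hr : Measurable fun ω : Vec n × (ℕ → Vec r) => ω.1 i := hi.comp measurable_fst
    -- The coordinate is Gaussian with variance `S₀ i i > 0`.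
    have hna : NullSingletonClass (S.noiseLaw.map fun ω => ω.1 i) := by
      have hp : MeasurePreserving (fun ω : Vec n × (ℕ → Vec r) => ω.1 i) S.noiseLaw
          (gaussianReal (S.μ₀ i) (S.S₀ i i).toNNReal) :=
        (measurePreserving_eval_multivariateGaussian hS.posSemidef).comp measurePreserving_fst
      rw [hp.map_eq]
      exact nullSingletonClass_gaussianReal (Real.toNNReal_pos.2 hS.diag_pos).ne'
    obtain ⟨s₁, s₂, a, h⟩ := exists_selection_measure_eq (ν := C.seedLaw) (μ := S.noiseLaw) hr (hm hZ)
    have hg : Measurable fun x : Vec n => if x i ≤ a then s₁ else s₂ :=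
      Measurable.ite (hi measurableSet_Iic) measurable_const measurable_const
    exact ⟨C.seedFromInitial _ hg, (S.outputLaw_seedFromInitial C hg hZ).trans h⟩

end Derandomization

end NoiseReduction

theorem theorem2 {n m p q : ℕ} (𝒰 : Set (NoiseReduction.Vec m))
    (A : Matrix (Fin n) (Fin n) ℝ) (B : Matrix (Fin n) (Fin m) ℝ) (H : Matrix (Fin p) (Fin n) ℝ)
    (μ₀ : NoiseReduction.Vec n) (S₀ Qw : Matrix (Fin n) (Fin n) ℝ)
    (C : Matrix (Fin q) (Fin n) ℝ) (N : Matrix (Fin p) (Fin q) ℝ)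
    (X : Matrix (Fin n) (Fin n) ℝ)
    (hQw : Qw.PosSemidef) (hNC : N * C = H)
    (hX : NoiseReduction.IsStabilizingSolution A C Qw X)
    (hSX : (S₀ - X).PosDef) (hCXC : (C * X * Cᵀ).PosDef)
    (Cbar : NoiseReduction.Controller n 𝒰) :
    (∀ Zφ : Set (ℕ → NoiseReduction.Vec p), MeasurableSet Zφ →
      (NoiseReduction.originalModel A B H μ₀ S₀ Qw).randomizedOutputLaw
          (NoiseReduction.refine A B μ₀ S₀ C X Cbar) Zφ =
        (NoiseReduction.abstractModel A B H μ₀ S₀ C X).outputLaw Cbar Zφ) ∧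
    (∀ Zφ : Set (ℕ → NoiseReduction.Vec p), MeasurableSet Zφ →
      ∃ Cor : NoiseReduction.Controller n 𝒰,
        (NoiseReduction.originalModel A B H μ₀ S₀ Qw).outputLaw Cor Zφ =
          (NoiseReduction.abstractModel A B H μ₀ S₀ C X).outputLaw Cbar Zφ) := by
  have hlaw := NoiseReduction.randomizedOutputLaw_refine B hNC μ₀ hQw hX hSX hCXC Cbar
  refine ⟨fun Zφ _ => by rw [hlaw], fun Zφ hZ => ?_⟩
  rw [← hlaw]
  refine NoiseReduction.LinearSystem.exists_controller_outputLaw_eq _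
    (NoiseReduction.posDef_initialCov hX.posDef hSX) _ (fun hn => ?_) hZ
  -- The seed `w̃` lives in `ℝⁿ`, which is a point for `n = 0`.
  subst hn
  exact inferInstanceAs (Subsingleton (NoiseReduction.Vec 0))
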